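/- Let $$X_1=\begin{pmatrix}0&0&0\\0&0&-1\\0&1&0\end{pmatrix},\quad X_2=\begin{pmatrix}0&0&1\\0&0&0\\-1&0&0\end{pmatrix},\quad X_3=\begin{pmatrix}0&-1&0\\1&0&0\\0&0&0\end{pmatrix},$$ let $SO(2)\subset SO(3)$ be the subgroup of rotations $\mathrm{diag}(h,1)$ about the third axis, with Lie algebra $so(2)\subset so(3)$, and let $so(3)/so(2)$ denote the $(-1)$-eigenspace in $so(3)$ of the involution $A\mapsto JAJ$, $J=\mathrm{diag}(-1,-1,1)$. Identify $SO(3)/SO(2)$ with $S^2$ by $g\,SO(2)\mapsto g e_3$. For $g\in SO(3)$ and a matrix $A$, the value of the left invariant field $x\mapsto xA$ at the point $g\,SO(2)$, computed with the representative $g$, is the image $gAe_3$ of $gA$ under the differential of $SO(3)\to SO(3)/SO(2)\cong S^2$. Put $\Theta^1=\mathrm{span}\{X_1,X_2\}$, $\Theta^{p+1}=\Theta^p+\mathrm{span}\{[[A,B],C]: A,C\in\Theta^1,\ B\in\Theta^p\}$ for $p\ge 1$, and $LTS\{X_1,X_2\}=\bigcup_{p\ge1}\Theta^p$, where $[A,B]=AB-BA$.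 Then: 1. $X_1,X_2$ form a basis of $so(3)/so(2)$; $so(2)=\mathbb{R}X_3$ and $so(3)=so(2)\oplus so(3)/so(2)$. 2. $[X_1,X_2]=X_3$, $[[X_1,X_2],X_1]=X_2$, $[[X_1,X_2],X_2]=-X_1$, and $so(3)/so(2)=\mathrm{span}\{X_1,X_2\}$ is a Lie triple system under $[A,B,C]=[[A,B],C]$: it is closed under this trilinear operation, which satisfies $[A,A,B]=0$, $[A,B,C]+[B,C,A]+[C,A,B]=0$ and $[A,B,[D,E,F]]=[[A,B,D],E,F]+[D,[A,B,E],F]+[D,E,[A,B,F]]$. 3. $\Theta^2=\Theta^1$ and $\dim\Theta^2=2$. 4. The map $g\,SO(2)\mapsto ge_3$ is a homeomorphism $SO(3)/SO(2)\to S^2$, and every tangent space $T_x(SO(3)/SO(2))=T_{x}S^2$ has dimension $2$. 5. Chow's condition holds: for every $x\in SO(3)/SO(2)$ and every representative $g\in SO(3)$ of $x$, $\{gAe_3 : A\in LTS\{X_1,X_2\}\}=T_x(SO(3)/SO(2))$. 6. The driftless system $\dot x=x(X_1u_1+X_2u_2)$ on $SO(3)/SO(2)$, whose trajectories are the curves $x(t)=g(t)\,SO(2)$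 with $\dot g=g(X_1u_1+X_2u_2)$ in $SO(3)$ (in the sense of Carathéodory), is globally controllable: for all $x_1,x_2\in SO(3)/SO(2)$, every $T>0$ and every representative $g_1$ of $x_1$ there is a control $u\in L^2([0,T],\mathbb{R}^2)$ such that the solution with $g(0)=g_1$ exists on $[0,T]$ and the corresponding trajectory satisfies $x(0)=x_1$, $x(T)=x_2$. -/

import Mathlib

open scoped Matrix Manifold

-- Matrices carry the commutator bracket `⁅A, B⁆ = A * B - B * A`.
attribute [local instance 100] LieRing.ofAssociativeRing

/-- A Lie triple system over a field `𝕂`: a vector space `L` with a trilinear operation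
`[A, B, C] = T A B C` subject to the three axioms below. -/
structure IsLieTripleSystem {𝕂 L : Type*} [Field 𝕂] [AddCommGroup L] [Module 𝕂 L]
    (T : L →ₗ[𝕂] L →ₗ[𝕂] L →ₗ[𝕂] L) : Prop where
  self_self : ∀ A B, T A A B = 0
  cyclic : ∀ A B C, T A B C + T B C A + T C A B = 0
  derivation : ∀ A B D E F,
    T A B (T D E F) = T (T A B D) E F + T D (T A B E) F + T D E (T A B F)

section Generated

variable {L : Type*} [LieRing L] [LieAlgebra ℝ L]

/-- `[[V, W], V] = span {[[A, B], C] : A, C ∈ V, B ∈ W}`. -/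
def doubleBracket (V W : Submodule ℝ L) : Submodule ℝ L :=
  Submodule.span ℝ {Z | ∃ A ∈ V, ∃ B ∈ W, ∃ C ∈ V, Z = ⁅⁅A, B⁆, C⁆}

/-- The spaces `Θ^p`, `p ≥ 1`, of a family `X`: `Θ^1 = span X` and
`Θ^(p+1) = Θ^p + [[Θ^1, Θ^p], Θ^1]`. (`Θ^0` is set to `0`.) -/
def Theta {ι : Type*} (X : ι → L) : ℕ → Submodule ℝ L
  | 0 => ⊥
  | 1 => Submodule.span ℝ (Set.range X)
  | p + 2 => Theta X (p + 1) ⊔ doubleBracket (Submodule.span ℝ (Set.range X)) (Theta X (p + 1))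

/-- `LTS X = ⋃_{p ≥ 1} Θ^p`. The spaces `Θ^p` increase, so that the supremum is the union. -/
def LTS {ι : Type*} (X : ι → L) : Submodule ℝ L := ⨆ p : ℕ, Theta X p

end Generated

/-- Real `3 × 3` matrices. -/
abbrev Mat3 : Type := Matrix (Fin 3) (Fin 3) ℝ

/-- Euclidean three-space. -/
abbrev E3 : Type := EuclideanSpace ℝ (Fin 3)

/-- The group `SO(3)`. -/
abbrev SO3 : Type := Matrix.specialOrthogonalGroup (Fin 3) ℝ

/-- The unit sphere `S²`, with the smooth structure it has in Mathlib. -/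
abbrev S2 : Type := Metric.sphere (0 : E3) 1

/-- Infinitesimal rotation about the first axis. -/
def X₁ : Mat3 := !![0, 0, 0; 0, 0, -1; 0, 1, 0]

/-- Infinitesimal rotation about the second axis. -/
def X₂ : Mat3 := !![0, 0, 1; 0, 0, 0; -1, 0, 0]

/-- Infinitesimal rotation about the third axis. -/
def X₃ : Mat3 := !![0, -1, 0; 1, 0, 0; 0, 0, 0]

/-- The two generators `X₁, X₂`. -/
def genSO : Fin 2 → Mat3 := ![X₁, X₂]

/-- The block diagonal matrix with blocks `h` and `c`. -/
def blockMat (h : Matrix (Fin 2) (Fin 2) ℝ) (c : ℝ) : Mat3 :=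
  !![h 0 0, h 0 1, 0; h 1 0, h 1 1, 0; 0, 0, c]

theorem blockMat_one : blockMat 1 1 = 1 := by
  ext i j; fin_cases i <;> fin_cases j <;> simp [blockMat]

theorem blockMat_mul (h k : Matrix (Fin 2) (Fin 2) ℝ) :
    blockMat h 1 * blockMat k 1 = blockMat (h * k) 1 := by
  ext i j
  fin_cases i <;> fin_cases j <;> simp [blockMat, Matrix.mul_apply, Fin.sum_univ_succ]

theorem blockMat_star (h : Matrix (Fin 2) (Fin 2) ℝ) :
    star (blockMat h 1) = blockMat (star h) 1 := by
  ext i j; fin_cases i <;> fin_cases j <;> simp [blockMat, Matrix.star_apply]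

/-- `SO(2)` as the subgroup of `SO(3)` of rotations about the third axis: `diag(h, 1)` with
`h ∈ SO(2)`. -/
def SO2 : Subgroup SO3 where
  carrier := {g | ∃ h ∈ Matrix.specialOrthogonalGroup (Fin 2) ℝ, (g : Mat3) = blockMat h 1}
  one_mem' := ⟨1, one_mem _, by simp [blockMat_one]⟩
  mul_mem' := by
    rintro a b ⟨h, hh, ha⟩ ⟨k, hk, hb⟩
    exact ⟨h * k, mul_mem hh hk, by simp [ha, hb, blockMat_mul]⟩
  inv_mem' := by
    rintro a ⟨h, hh, ha⟩
    refine ⟨star h, ((⟨h, hh⟩ : Matrix.specialOrthogonalGroup (Fin 2) ℝ)⁻¹).2, ?_⟩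
    rw [← blockMat_star, ← ha]
    rfl

/-- The Lie algebra `so(2)` inside `so(3)`: `diag(h, 0)` with `h ∈ so(2)`. -/
def soTwo : Submodule ℝ Mat3 where
  carrier := {A | ∃ h ∈ LieAlgebra.Orthogonal.so (Fin 2) ℝ, A = blockMat h 0}
  zero_mem' := ⟨0, zero_mem _, by
    ext i j; fin_cases i <;> fin_cases j <;> simp [blockMat]⟩
  add_mem' := by
    rintro _ _ ⟨h, hh, rfl⟩ ⟨k, hk, rfl⟩
    refine ⟨h + k, add_mem hh hk, ?_⟩
    ext i j; fin_cases i <;> fin_cases j <;> simp [blockMat]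
  smul_mem' := by
    rintro c _ ⟨h, hh, rfl⟩
    refine ⟨c • h, SMulMemClass.smul_mem c hh, ?_⟩
    ext i j; fin_cases i <;> fin_cases j <;> simp [blockMat]

/-- The involutive automorphism `A ↦ J A J`, `J = diag(-1, -1, 1)`. -/
def sigma (A : Mat3) : Mat3 :=
  Matrix.diagonal ![-1, -1, 1] * A * Matrix.diagonal ![-1, -1, 1]

/-- The space written `so(3)/so(2)`: the `(-1)`-eigenspace of the involution `sigma` in `so(3)`. -/
def soThreeModSoTwo : Submodule ℝ Mat3 where
  carrier := {A | A ∈ LieAlgebra.Orthogonal.so (Fin 3) ℝ ∧ sigma A = -A}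
  zero_mem' := ⟨zero_mem _, by simp [sigma]⟩
  add_mem' := by
    rintro A B ⟨hA, hA'⟩ ⟨hB, hB'⟩
    refine ⟨add_mem hA hB, ?_⟩
    have : sigma (A + B) = sigma A + sigma B := by simp [sigma, mul_add, add_mul]
    rw [this, hA', hB', neg_add]
  smul_mem' := by
    rintro c A ⟨hA, hA'⟩
    refine ⟨SMulMemClass.smul_mem c hA, ?_⟩
    have : sigma (c • A) = c • sigma A := by simp [sigma]
    rw [this, hA', smul_neg]

/-- The symmetric space `SO(3)/SO(2)`, the space of left cosets with the quotient topology. -/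
abbrev SymSpace : Type := SO3 ⧸ SO2

/-- The base point `e₃` of the sphere. -/
noncomputable def e₃ : E3 := EuclideanSpace.single 2 1

/-- A matrix applied to a vector of Euclidean three-space. -/
noncomputable def act (M : Mat3) (v : E3) : E3 := WithLp.toLp 2 (M *ᵥ (v : Fin 3 → ℝ))

theorem norm_act (g : SO3) : act g e₃ ∈ Metric.sphere (0 : E3) 1 := by
  have h := (Matrix.mem_specialOrthogonalGroup_iff.1 g.2).1
  rw [Matrix.mem_orthogonalGroup_iff'] at h
  have h2 := congrFun (congrFun h 2) 2
  simp [Matrix.mul_apply, Fin.sum_univ_three] at h2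
  simp [act, e₃, EuclideanSpace.norm_eq, Fin.sum_univ_three]
  nlinarith [h2]

/-- The map `SO(3) → S²`, `g ↦ g e₃`. -/
noncomputable def orbitMap (g : SO3) : S2 := ⟨act g e₃, norm_act g⟩

theorem orbitMap_mul (g k : SO3) (hk : k ∈ SO2) : orbitMap (g * k) = orbitMap g := by
  obtain ⟨h, -, hk⟩ := hk
  have h1 : blockMat h 1 *ᵥ (e₃ : Fin 3 → ℝ) = e₃ := by
    ext i; fin_cases i <;> simp [blockMat, e₃, Matrix.mulVec, dotProduct]
  apply Subtype.ext
  simp only [orbitMap, act, Submonoid.coe_mul, hk, ← Matrix.mulVec_mulVec, h1]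

/-- The identification of `SO(3)/SO(2)` with `S²`, `g SO(2) ↦ g e₃`. -/
noncomputable def toSphere (x : SymSpace) : S2 :=
  Quotient.liftOn' x orbitMap (by
    intro a b hab
    rw [QuotientGroup.leftRel_apply] at hab
    have := orbitMap_mul a _ hab
    rw [mul_inv_cancel_left] at this
    exact this.symm)

/-- The tangent space of `SO(3)/SO(2) ≅ S²` at `x`, as a linear subspace of Euclidean three-space:
the image of the tangent space of the manifold `S²` under the differential of the inclusion. -/
noncomputable def tangentAt (x : SymSpace) : Submodule ℝ E3 :=
  LinearMap.range (mfderiv (𝓡 2) 𝓘(ℝ, E3) ((↑) : S2 → E3) (toSphere x) :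
    EuclideanSpace ℝ (Fin 2) →L[ℝ] E3).toLinearMap

/-- The value of the left invariant field of `A` at the point `g SO(2)`, computed with the
representative `g`: the vector `g A e₃ = d/dt (g exp(tA) e₃)` at `t = 0`, that is, the image of
`g A` under the differential of the projection `SO(3) → SO(3)/SO(2) ≅ S²`. -/
noncomputable def fieldAt (g : SO3) : Mat3 →ₗ[ℝ] E3 where
  toFun A := act ((g : Mat3) * A) e₃
  map_add' A B := by simp [act, mul_add, Matrix.add_mulVec]
  map_smul' c A := by simp [act, Matrix.smul_mulVec]

/-- Chow's condition: at every point `x` of `SO(3)/SO(2)`, and for every representative `g` of `x`,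
`LTS(X)(x) = T_x (SO(3)/SO(2))`. -/
def ChowCondition {m : ℕ} (X : Fin m → Mat3) : Prop :=
  ∀ (x : SymSpace) (g : SO3), (g : SymSpace) = x → (LTS X).map (fieldAt g) = tangentAt x

/-- `g` is a (Carathéodory) solution on `[0, T]` of `ġ = g (∑ i, u_i X_i)`, `g 0 = g₀`, in
`SO(3)`. -/
def IsSolution {m : ℕ} (X : Fin m → Mat3) (T : ℝ) (u : ℝ → EuclideanSpace ℝ (Fin m))
    (g₀ : SO3) (g : ℝ → SO3) : Prop :=
  ContinuousOn g (Set.Icc 0 T) ∧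
    ∀ t ∈ Set.Icc 0 T, ∀ i j, (g t : Mat3) i j =
      (g₀ : Mat3) i j + ∫ s in (0 : ℝ)..t, ((g s : Mat3) * ∑ k, u s k • X k) i j

/-- Global controllability of `ẋ = x (∑ i, X_i u_i)` on `SO(3)/SO(2)`: for all points `x₁, x₂`,
every time `T > 0` and every representative `g₁` of `x₁`, some control `u ∈ L²([0, T], ℝ^m)` is
such that the solution `x(t) = g(t) SO(2)` with `g(0) = g₁` exists on `[0, T]` and satisfies
`x(T) = x₂`. -/
def GloballyControllable {m : ℕ} (X : Fin m → Mat3) : Prop :=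
  ∀ (x₁ x₂ : SymSpace) (T : ℝ), 0 < T → ∀ g₁ : SO3, (g₁ : SymSpace) = x₁ →
    ∃ u : ℝ → EuclideanSpace ℝ (Fin m),
      MeasureTheory.MemLp u 2 (MeasureTheory.volume.restrict (Set.Icc 0 T)) ∧
      (∃ g : ℝ → SO3, IsSolution X T u g₁ g) ∧
      ∀ g : ℝ → SO3, IsSolution X T u g₁ g → (g T : SymSpace) = x₂

/-! Write `m` for the span of `X₁, X₂`. Its brackets lie in `ℝ X₃`, and `ad X₃` rotates the plane
`m` by a quarter turn, so `[[m, m], m] ⊆ m`. Hence the spaces `Θ^p` are already stationary at `p =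
1`, and `LTS` is `m` (`LTS_genSO`). Chow's condition is then orthogonality: `m e₃` is the plane
orthogonal to `e₃`, and `g` carries it isometrically onto the plane orthogonal to `g e₃`, which is
the tangent plane of the sphere (`tangentAt_mk`). Controllability needs only constant controls.
Rotations about horizontal axes move `e₃` along the great circles through it, and these cover the
sphere (`exists_rot_eq`). Left translation by `g₁` transfers this to any starting point. A
conservation law gives uniqueness of the solution (`IsSolution.eq_mul`). -/

/-! ### The splitting of so(3) under the involution -/

theorem mem_soThreeModSoTwo_iff (A : Mat3) :
    A ∈ soThreeModSoTwo ↔ ∃ a b : ℝ, A = a • X₁ + b • X₂ := by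
  constructor
  · rintro ⟨h, h'⟩
    rw [LieAlgebra.Orthogonal.mem_so] at h
    have e (i j) : A j i = - A i j := congrFun (congrFun h i) j
    have s (i j) : sigma A i j = - A i j := congrFun (congrFun h' i) j
    have h00 := e 0 0
    have h11 := e 1 1
    have h22 := e 2 2
    have h02 := e 0 2
    have h12 := e 1 2
    have h01 := e 0 1
    -- `sigma` fixes this entry, so it equals its own negative and vanishes.
    have s01 := s 0 1
    simp [sigma, Matrix.diagonal_mul, Matrix.mul_diagonal] at s01
    refine ⟨A 2 1, A 0 2, ?_⟩
    ext i j
    fin_cases i <;> fin_cases j <;> simp [X₁, X₂] <;> linarith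
  · rintro ⟨a, b, rfl⟩
    refine ⟨?_, ?_⟩
    · rw [LieAlgebra.Orthogonal.mem_so]
      ext i j
      fin_cases i <;> fin_cases j <;> simp [X₁, X₂]
    · ext i j
      fin_cases i <;> fin_cases j <;>
        simp [sigma, X₁, X₂, Matrix.diagonal_mul, Matrix.mul_diagonal]

theorem mem_span_genSO_iff (A : Mat3) :
    A ∈ Submodule.span ℝ (Set.range genSO) ↔ ∃ a b : ℝ, A = a • X₁ + b • X₂ := by
  have : Set.range genSO = {X₁, X₂} := by
    simp [genSO, Matrix.range_cons, Matrix.range_empty, Set.pair_comm]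
  rw [this, Submodule.mem_span_pair]
  simp only [eq_comm]

theorem span_genSO : Submodule.span ℝ (Set.range genSO) = soThreeModSoTwo := by
  ext A
  rw [mem_span_genSO_iff, mem_soThreeModSoTwo_iff]

theorem linearIndependent_genSO : LinearIndependent ℝ genSO := by
  rw [genSO, LinearIndependent.pair_iff]
  intro a b h
  have h1 := congrFun (congrFun h 2) 1
  have h2 := congrFun (congrFun h 0) 2
  simp [X₁, X₂] at h1 h2
  exact ⟨h1, h2⟩

theorem mem_soTwo_iff (A : Mat3) : A ∈ soTwo ↔ ∃ c : ℝ, A = c • X₃ := by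
  constructor
  · rintro ⟨h, hh, rfl⟩
    rw [LieAlgebra.Orthogonal.mem_so] at hh
    have e (i j) : h j i = - h i j := congrFun (congrFun hh i) j
    have h00 := e 0 0
    have h11 := e 1 1
    have h01 := e 0 1
    refine ⟨h 1 0, ?_⟩
    ext i j
    fin_cases i <;> fin_cases j <;> simp [X₃, blockMat] <;> linarith
  · rintro ⟨c, rfl⟩
    refine ⟨!![0, -c; c, 0], ?_, ?_⟩
    · rw [LieAlgebra.Orthogonal.mem_so]
      ext i j
      fin_cases i <;> fin_cases j <;> simp
    · ext i j
      fin_cases i <;> fin_cases j <;> simp [X₃, blockMat]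

theorem soTwo_eq_span : soTwo = Submodule.span ℝ {X₃} := by
  ext A
  rw [mem_soTwo_iff, Submodule.mem_span_singleton]
  simp only [eq_comm]

theorem disjoint_soTwo_soThreeModSoTwo : Disjoint soTwo soThreeModSoTwo := by
  rw [Submodule.disjoint_def]
  intro A hA hB
  obtain ⟨c, rfl⟩ := (mem_soTwo_iff A).1 hA
  obtain ⟨a, b, h⟩ := (mem_soThreeModSoTwo_iff _).1 hB
  have h1 := congrFun (congrFun h 1) 0
  simp [X₁, X₂, X₃] at h1
  simp [h1]

theorem soTwo_sup_soThreeModSoTwo :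
    soTwo ⊔ soThreeModSoTwo = (LieAlgebra.Orthogonal.so (Fin 3) ℝ).toSubmodule := by
  apply le_antisymm
  · refine sup_le ?_ fun A hA => hA.1
    intro A hA
    obtain ⟨c, rfl⟩ := (mem_soTwo_iff A).1 hA
    rw [LieSubalgebra.mem_toSubmodule, LieAlgebra.Orthogonal.mem_so]
    ext i j
    fin_cases i <;> fin_cases j <;> simp [X₃]
  · intro A hA
    rw [LieSubalgebra.mem_toSubmodule, LieAlgebra.Orthogonal.mem_so] at hA
    have e (i j) : A j i = - A i j := congrFun (congrFun hA i) j
    rw [Submodule.mem_sup]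
    refine ⟨A 1 0 • X₃, (mem_soTwo_iff _).2 ⟨_, rfl⟩, A 2 1 • X₁ + A 0 2 • X₂,
      (mem_soThreeModSoTwo_iff _).2 ⟨_, _, rfl⟩, ?_⟩
    have h00 := e 0 0
    have h11 := e 1 1
    have h22 := e 2 2
    have h02 := e 0 2
    have h12 := e 1 2
    have h01 := e 0 1
    ext i j
    fin_cases i <;> fin_cases j <;> simp [X₁, X₂, X₃] <;> linarith

/-! ### Brackets and the Lie triple system -/

theorem lie_X₁_X₂ : ⁅X₁, X₂⁆ = X₃ := by
  rw [Ring.lie_def]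
  ext i j
  fin_cases i <;> fin_cases j <;> simp [X₁, X₂, X₃]

theorem lie_X₃_X₁ : ⁅X₃, X₁⁆ = X₂ := by
  rw [Ring.lie_def]
  ext i j
  fin_cases i <;> fin_cases j <;> simp [X₁, X₂, X₃]

theorem lie_X₃_X₂ : ⁅X₃, X₂⁆ = -X₁ := by
  rw [Ring.lie_def]
  ext i j
  fin_cases i <;> fin_cases j <;> simp [X₁, X₂, X₃]

theorem lie_lie_mem_soThreeModSoTwo {A B C : Mat3} (hA : A ∈ soThreeModSoTwo)
    (hB : B ∈ soThreeModSoTwo) (hC : C ∈ soThreeModSoTwo) :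
    ⁅⁅A, B⁆, C⁆ ∈ soThreeModSoTwo := by
  refine ⟨LieSubalgebra.lie_mem _ (LieSubalgebra.lie_mem _ hA.1 hB.1) hC.1, ?_⟩
  obtain ⟨a, b, rfl⟩ := (mem_soThreeModSoTwo_iff A).1 hA
  obtain ⟨c, d, rfl⟩ := (mem_soThreeModSoTwo_iff B).1 hB
  obtain ⟨e, f, rfl⟩ := (mem_soThreeModSoTwo_iff C).1 hC
  have h : ⁅a • X₁ + b • X₂, c • X₁ + d • X₂⁆ = (a * d - b * c) • X₃ := by
    have : ⁅X₂, X₁⁆ = -X₃ := by rw [← lie_skew, lie_X₁_X₂]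
    simp only [add_lie, lie_add, smul_lie, lie_smul, lie_self, lie_X₁_X₂, this]
    module
  rw [h]
  have h' : ⁅(a * d - b * c) • X₃, e • X₁ + f • X₂⁆ =
      (-(a * d - b * c) * f) • X₁ + ((a * d - b * c) * e) • X₂ := by
    simp only [lie_add, smul_lie, lie_smul, lie_X₃_X₁, lie_X₃_X₂]
    module
  rw [h']
  exact ((mem_soThreeModSoTwo_iff _).2 ⟨_, _, rfl⟩).2

/-- The double commutator on `so(3)/so(2)`. -/
def tripleBracket :
    soThreeModSoTwo →ₗ[ℝ] soThreeModSoTwo →ₗ[ℝ] soThreeModSoTwo →ₗ[ℝ] soThreeModSoTwo :=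
  LinearMap.mk₂ ℝ
    (fun A B => (LieAlgebra.ad ℝ Mat3 ⁅(A : Mat3), (B : Mat3)⁆).restrict
      fun _ hC => lie_lie_mem_soThreeModSoTwo A.2 B.2 hC)
    (fun A A' B => by ext1 C; apply Subtype.ext; simp)
    (fun c A B => by ext1 C; apply Subtype.ext; simp)
    (fun A B B' => by ext1 C; apply Subtype.ext; simp)
    (fun c A B => by ext1 C; apply Subtype.ext; simp)

theorem coe_tripleBracket (A B C : soThreeModSoTwo) :
    (tripleBracket A B C : Mat3) = ⁅⁅(A : Mat3), (B : Mat3)⁆, (C : Mat3)⁆ := rfl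

/-- The axioms hold for double commutators in any associative algebra: `cyclic` is the Jacobi
identity, and `derivation` says that `ad ⁅A, B⁆` is a derivation. -/
theorem isLieTripleSystem_tripleBracket : IsLieTripleSystem tripleBracket where
  self_self A B := by
    apply Subtype.ext
    simp [coe_tripleBracket]
  cyclic A B C := by
    apply Subtype.ext
    simp only [Submodule.coe_add, coe_tripleBracket, Ring.lie_def, Submodule.coe_zero]
    noncomm_ring
  derivation A B D E F := by
    apply Subtype.ext
    simp only [Submodule.coe_add, coe_tripleBracket, Ring.lie_def]
    noncomm_ring

theorem Theta_genSO_le (p : ℕ) : Theta genSO p ≤ soThreeModSoTwo := by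
  induction p using Nat.twoStepInduction with
  | zero => exact bot_le
  | one => exact span_genSO.le
  | more p _ ih =>
    refine sup_le ih ?_
    rw [doubleBracket, Submodule.span_le, span_genSO]
    rintro _ ⟨A, hA, B, hB, C, hC, rfl⟩
    exact lie_lie_mem_soThreeModSoTwo hA (ih hB) hC

theorem Theta_genSO_one : Theta genSO 1 = soThreeModSoTwo := span_genSO

theorem Theta_genSO_two : Theta genSO 2 = soThreeModSoTwo :=
  (Theta_genSO_le 2).antisymm (Theta_genSO_one.symm.le.trans le_sup_left)

theorem LTS_genSO : LTS genSO = soThreeModSoTwo :=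
  (iSup_le Theta_genSO_le).antisymm
    (Theta_genSO_one.symm.le.trans (le_iSup (Theta genSO) 1))

theorem finrank_soThreeModSoTwo : Module.finrank ℝ soThreeModSoTwo = 2 := by
  rw [← span_genSO, finrank_span_eq_card linearIndependent_genSO, Fintype.card_fin]

/-! ### Tangent planes and Chow's condition -/

theorem SO3.transpose_mul_self (g : SO3) : (g : Mat3)ᵀ * (g : Mat3) = 1 :=
  (Matrix.mem_orthogonalGroup_iff' _ _).1 (Matrix.mem_specialOrthogonalGroup_iff.1 g.2).1

theorem SO3.mul_transpose_self (g : SO3) : (g : Mat3) * (g : Mat3)ᵀ = 1 :=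
  (Matrix.mem_orthogonalGroup_iff _ _).1 (Matrix.mem_specialOrthogonalGroup_iff.1 g.2).1

theorem act_mul (M N : Mat3) (v : E3) : act (M * N) v = act M (act N v) := by
  simp [act, Matrix.mulVec_mulVec]

theorem act_one (v : E3) : act 1 v = v := by
  ext i
  simp [act]

theorem inner_act (M : Mat3) (v w : E3) : inner ℝ (act M v) w = inner ℝ v (act Mᵀ w) := by
  simp [act, PiLp.inner_apply, Matrix.mulVec, dotProduct, Fin.sum_univ_three]
  ring

theorem act_e₃_apply (M : Mat3) (i : Fin 3) : act M e₃ i = M i 2 := by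
  simp [act, e₃]

theorem tangentAt_mk (g : SO3) : tangentAt (g : SymSpace) = (ℝ ∙ act g e₃)ᗮ :=
  have : Fact (Module.finrank ℝ E3 = 2 + 1) := ⟨finrank_euclideanSpace_fin⟩
  range_mvfderiv_subtypeVal (orbitMap g)

theorem finrank_tangentAt (x : SymSpace) : Module.finrank ℝ (tangentAt x) = 2 := by
  induction x using QuotientGroup.induction_on with
  | H g =>
    rw [tangentAt_mk]
    have : Fact (Module.finrank ℝ E3 = 2 + 1) := ⟨by simp⟩
    exact Submodule.finrank_orthogonal_span_singleton (ne_zero_of_mem_unit_sphere (orbitMap g))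

theorem chowCondition_genSO : ChowCondition genSO := by
  rintro _ g rfl
  rw [LTS_genSO, tangentAt_mk]
  ext w
  rw [Submodule.mem_map, Submodule.mem_orthogonal_singleton_iff_inner_right, inner_act]
  constructor
  · rintro ⟨A, hA, rfl⟩
    obtain ⟨a, b, rfl⟩ := (mem_soThreeModSoTwo_iff A).1 hA
    change inner ℝ e₃ (act _ (act _ e₃)) = 0
    rw [← act_mul, ← mul_assoc, g.transpose_mul_self, one_mul]
    simp [e₃, EuclideanSpace.inner_single_left, act, X₁, X₂]
  · intro hw
    set v := act (g : Mat3)ᵀ w with hv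
    have h2 : v 2 = 0 := by simpa [e₃, EuclideanSpace.inner_single_left] using hw
    -- Since `(a X₁ + b X₂) e₃ = (b, -a, 0)`, the coefficients are forced.
    refine ⟨-v 1 • X₁ + v 0 • X₂, (mem_soThreeModSoTwo_iff _).2 ⟨_, _, rfl⟩, ?_⟩
    change act _ e₃ = w
    have : act (-v 1 • X₁ + v 0 • X₂) e₃ = v := by
      ext i
      rw [act_e₃_apply]
      fin_cases i <;> simp [X₁, X₂, h2]
    rw [act_mul, this, hv, ← act_mul, g.mul_transpose_self, act_one]

/-! ### Horizontal rotations and the identification with the sphere -/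

/-- The rotation `exp (θ (a X₁ + b X₂))`, where `a² + b² = 1`, `c = cos θ` and `s = sin θ`. -/
def rot (a b c s : ℝ) : Mat3 :=
  !![1 - (1 - c) * b ^ 2, (1 - c) * (a * b), s * b;
    (1 - c) * (a * b), 1 - (1 - c) * a ^ 2, -(s * a);
    -(s * b), s * a, c]

theorem rot_mem {a b c s : ℝ} (hab : a ^ 2 + b ^ 2 = 1) (hcs : c ^ 2 + s ^ 2 = 1) :
    rot a b c s ∈ Matrix.specialOrthogonalGroup (Fin 3) ℝ := by
  have ha : a ^ 2 = 1 - b ^ 2 := by linarith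
  have hs : s ^ 2 = 1 - c ^ 2 := by linarith
  rw [Matrix.mem_specialOrthogonalGroup_iff, Matrix.mem_orthogonalGroup_iff]
  constructor
  · ext i j
    fin_cases i <;> fin_cases j <;>
      simp [rot, Matrix.mul_apply, Fin.sum_univ_three] <;> ring_nf <;> grind
  · simp [rot, Matrix.det_fin_three]
    grind

theorem rot_one_zero (a b : ℝ) : rot a b 1 0 = 1 := by
  ext i j
  fin_cases i <;> fin_cases j <;> simp [rot]

theorem exists_rot_eq (v : S2) : ∃ a b θ : ℝ, a ^ 2 + b ^ 2 = 1 ∧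
    act (rot a b (Real.cos θ) (Real.sin θ)) e₃ = v := by
  obtain ⟨v, hv⟩ := v
  have hn : v 0 ^ 2 + v 1 ^ 2 + v 2 ^ 2 = 1 := by
    rw [mem_sphere_zero_iff_norm] at hv
    have := EuclideanSpace.norm_sq_eq v
    simp [hv, Fin.sum_univ_three] at this
    linarith
  have hc : Real.cos (Real.arccos (v 2)) = v 2 :=
    Real.cos_arccos (by nlinarith [sq_nonneg (v 0), sq_nonneg (v 1)])
      (by nlinarith [sq_nonneg (v 0), sq_nonneg (v 1)])
  set θ := Real.arccos (v 2)
  have hs : v 0 ^ 2 + v 1 ^ 2 = Real.sin θ ^ 2 := by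
    rw [Real.sin_sq, hc]
    linarith
  -- At the poles every horizontal axis serves; elsewhere `rot a b c s` sends `e₃` to `(s b, -s a,
  -- c)`, which determines `a` and `b`.
  by_cases h : Real.sin θ = 0
  · have h0 : v 0 = 0 := by nlinarith [sq_nonneg (v 0), sq_nonneg (v 1)]
    have h1 : v 1 = 0 := by nlinarith [sq_nonneg (v 0), sq_nonneg (v 1)]
    refine ⟨1, 0, θ, by norm_num, ?_⟩
    ext i
    rw [act_e₃_apply]
    fin_cases i <;> simp [rot, h, h0, h1, hc]
  · refine ⟨-(v 1) / Real.sin θ, v 0 / Real.sin θ, θ, ?_, ?_⟩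
    · field_simp
      linarith
    · ext i
      rw [act_e₃_apply]
      fin_cases i <;> simp [rot, hc] <;> field_simp

theorem surjective_toSphere : Function.Surjective toSphere := by
  intro v
  obtain ⟨a, b, θ, hab, h⟩ := exists_rot_eq v
  exact ⟨((⟨_, rot_mem hab (Real.cos_sq_add_sin_sq θ)⟩ : SO3) : SymSpace), Subtype.ext h⟩

/-- The third column of `g` is `e₃`. As `gᵀ = g⁻¹` also fixes `e₃`, so is the third row, and the
remaining block inherits orthogonality and determinant one. -/
theorem mem_SO2_of_act_e₃ {g : SO3} (h : act g e₃ = e₃) : g ∈ SO2 := by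
  have hc (i : Fin 3) : (g : Mat3) i 2 = e₃ i := by rw [← act_e₃_apply (g : Mat3), h]
  have c0 := hc 0
  have c1 := hc 1
  have c2 := hc 2
  have hr (i : Fin 3) : (g : Mat3) 2 i = e₃ i := by
    rw [← Matrix.transpose_apply (g : Mat3), ← act_e₃_apply (g : Mat3)ᵀ i]
    nth_rw 1 [← h]
    rw [← act_mul, g.transpose_mul_self, act_one]
  have r0 := hr 0
  have r1 := hr 1
  simp [e₃] at c0 c1 c2 r0 r1
  have hg : (g : Mat3) = blockMat !![g.1 0 0, g.1 0 1; g.1 1 0, g.1 1 1] 1 := by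
    ext i j
    fin_cases i <;> fin_cases j <;> simp [blockMat, c0, c1, c2, r0, r1]
  refine ⟨_, ?_, hg⟩
  have ho := g.mul_transpose_self
  have o00 := congrFun (congrFun ho 0) 0
  have o01 := congrFun (congrFun ho 0) 1
  have o11 := congrFun (congrFun ho 1) 1
  have hd := (Matrix.mem_specialOrthogonalGroup_iff.1 g.2).2
  simp [Matrix.mul_apply, Fin.sum_univ_three, c0, c1] at o00 o01 o11
  simp [Matrix.det_fin_three, c0, c1, c2, r0, r1] at hd
  rw [Matrix.mem_specialOrthogonalGroup_iff, Matrix.mem_orthogonalGroup_iff]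
  constructor
  · ext i j
    fin_cases i <;> fin_cases j <;> simp [Matrix.mul_apply] <;> linarith
  · simpa [Matrix.det_fin_two] using hd

theorem injective_toSphere : Function.Injective toSphere := by
  intro x y h
  induction x using QuotientGroup.induction_on with
  | H g =>
    induction y using QuotientGroup.induction_on with
    | H k =>
      have h' : act g e₃ = act k e₃ := congrArg Subtype.val h
      rw [QuotientGroup.eq]
      apply mem_SO2_of_act_e₃
      -- The inverse in `SO3` is the star, which over `ℝ` unfolds to the transpose.
      change act ((g : Mat3)ᵀ * (k : Mat3)) e₃ = e₃
      rw [act_mul, ← h', ← act_mul, g.transpose_mul_self, act_one]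

theorem continuous_toSphere : Continuous toSphere := by
  refine Continuous.quotient_liftOn' ?_ _
  refine Continuous.subtype_mk ?_ _
  unfold act
  fun_prop

/-- Rows are unit vectors, so the group is a closed subset of a cube. Compactness makes the
continuous bijection `toSphere` a homeomorphism. -/
theorem compactSpace_SO3 : CompactSpace SO3 := by
  apply isCompact_iff_compactSpace.1
  have hsub : ((Matrix.specialOrthogonalGroup (Fin 3) ℝ : Submonoid Mat3) : Set Mat3) ⊆
      Set.univ.pi fun _ => Set.univ.pi fun _ => Set.Icc (-1) 1 := by
    intro g hg i _ j _
    have h := congrFun (congrFun (SO3.mul_transpose_self ⟨g, hg⟩) i) i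
    simp [Matrix.mul_apply, Fin.sum_univ_three] at h
    apply abs_le.1
    apply abs_le_one_iff_mul_self_le_one.2
    fin_cases j <;> simp <;> nlinarith [sq_nonneg (g i 0), sq_nonneg (g i 1), sq_nonneg (g i 2)]
  refine IsCompact.of_isClosed_subset
    (isCompact_univ_pi fun _ => isCompact_univ_pi fun _ => isCompact_Icc) ?_ hsub
  have : ((Matrix.specialOrthogonalGroup (Fin 3) ℝ : Submonoid Mat3) : Set Mat3) =
      {g : Mat3 | g * gᵀ = 1 ∧ g.det = 1} := by
    ext g
    exact Matrix.mem_specialOrthogonalGroup_iff.trans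
      (and_congr_left' (Matrix.mem_orthogonalGroup_iff _ _))
  rw [this]
  exact (isClosed_eq (by fun_prop) continuous_const).inter
    (isClosed_eq (by fun_prop) continuous_const)

theorem isHomeomorph_toSphere : IsHomeomorph toSphere := by
  have := compactSpace_SO3
  exact isHomeomorph_iff_continuous_bijective.2
    ⟨continuous_toSphere, injective_toSphere, surjective_toSphere⟩

/-! ### Solutions for constant controls -/

theorem hasDerivAt_rot {a b : ℝ} (hab : a ^ 2 + b ^ 2 = 1) (c t : ℝ) (i j : Fin 3) :
    HasDerivAt (fun t => rot a b (Real.cos (c * t)) (Real.sin (c * t)) i j)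
      ((rot a b (Real.cos (c * t)) (Real.sin (c * t)) * (c • (a • X₁ + b • X₂))) i j) t := by
  have hl : HasDerivAt (fun t : ℝ => c * t) c t := by
    simpa using (hasDerivAt_id t).const_mul c
  have hc := hl.cos
  have hs := hl.sin
  fin_cases i <;> fin_cases j <;>
    simp [rot, X₁, X₂, Matrix.mul_apply, Fin.sum_univ_three]
  · refine (((hc.const_sub 1).mul_const (b ^ 2)).const_sub 1).congr_deriv ?_
    ring
  · refine ((hc.const_sub 1).mul_const (a * b)).congr_deriv ?_
    ring
  · refine (hs.mul_const b).congr_deriv ?_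
    linear_combination (1 - Real.cos (c * t)) * c * b * hab
  · refine ((hc.const_sub 1).mul_const (a * b)).congr_deriv ?_
    ring
  · refine (((hc.const_sub 1).mul_const (a ^ 2)).const_sub 1).congr_deriv ?_
    ring
  · refine (hs.mul_const a).neg.congr_deriv ?_
    linear_combination -(1 - Real.cos (c * t)) * c * a * hab
  · refine (hs.mul_const b).neg.congr_deriv ?_
    ring
  · refine (hs.mul_const a).congr_deriv ?_
    ring
  · refine hc.congr_deriv ?_
    linear_combination Real.sin (c * t) * c * hab

/-- Differentiation of a continuous solution of an integral equation. -/
theorem hasDerivWithinAt_of_eq_integral {T f₀ : ℝ} {f φ : ℝ → ℝ}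
    (hφ : ContinuousOn φ (Set.Icc 0 T))
    (hf : ∀ t ∈ Set.Icc 0 T, f t = f₀ + ∫ s in (0 : ℝ)..t, φ s) {t : ℝ}
    (ht : t ∈ Set.Icc 0 T) : HasDerivWithinAt f (φ t) (Set.Icc 0 T) t := by
  have hT : 0 ≤ T := ht.1.trans ht.2
  -- `φ` is controlled only on `[0, T]`; its extension by constants is continuous on `ℝ`, so the
  -- fundamental theorem of calculus also applies at the endpoints.
  have hψ : Continuous (Set.IccExtend hT ((Set.Icc 0 T).domRestrict φ)) :=
    (continuousOn_iff_continuous_domRestrict.1 hφ).Icc_extend'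
  have heq (s) (hs : s ∈ Set.Icc 0 T) : Set.IccExtend hT ((Set.Icc 0 T).domRestrict φ) s = φ s := by
    rw [Set.IccExtend_of_mem _ _ hs, Set.domRestrict_apply]
  have h := (intervalIntegral.integral_hasDerivAt_right (hψ.intervalIntegrable 0 t)
    hψ.stronglyMeasurable.stronglyMeasurableAtFilter hψ.continuousAt).const_add f₀
  rw [heq t ht] at h
  have key (r) (hr : r ∈ Set.Icc 0 T) :
      f r = f₀ + ∫ s in (0 : ℝ)..r, Set.IccExtend hT ((Set.Icc 0 T).domRestrict φ) s := by
    rw [hf r hr]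
    congr 1
    refine intervalIntegral.integral_congr fun s hs => (heq s ?_).symm
    rw [Set.uIcc_of_le hr.1] at hs
    exact ⟨hs.1, hs.2.trans hr.2⟩
  exact h.hasDerivWithinAt.congr key (key t ht)

section ConstantControl

variable {m : ℕ} {X : Fin m → Mat3} {T : ℝ} {u : EuclideanSpace ℝ (Fin m)} {R : ℝ → Mat3}

/-- A fundamental solution determines every solution with the same constant control. -/
theorem IsSolution.eq_mul (hu : (∑ k, u k • X k)ᵀ = -∑ k, u k • X k)
    (hR : ∀ t i j, HasDerivAt (fun t => R t i j) ((R t * ∑ k, u k • X k) i j) t)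
    (hR₀ : R 0 = 1) (hRR : ∀ t, (R t)ᵀ * R t = 1) {g₀ : SO3} {g : ℝ → SO3}
    (hg : IsSolution X T (fun _ => u) g₀ g) {t : ℝ} (ht : t ∈ Set.Icc 0 T) :
    (g t : Mat3) = (g₀ : Mat3) * R t := by
  obtain ⟨hc, hg⟩ := hg
  set M := ∑ k, u k • X k
  have hcM (N : Mat3) (i j) : ContinuousOn (fun s => ((g s : Mat3) * N) i j) (Set.Icc 0 T) := by
    have : Continuous fun h : SO3 => ((h : Mat3) * N) i j := by fun_prop
    exact this.comp_continuousOn hc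
  have hd (i j) (s) (hs : s ∈ Set.Icc 0 T) :
      HasDerivWithinAt (fun s => (g s : Mat3) i j) (((g s : Mat3) * M) i j) (Set.Icc 0 T) s :=
    hasDerivWithinAt_of_eq_integral (hcM M i j) (fun r hr => hg r hr i j) hs
  -- `g Rᵀ` is conserved: its derivative is `g M Rᵀ + g Mᵀ Rᵀ`, which vanishes because `M` is skew.
  have hdP (i j) (s) (hs : s ∈ Set.Icc 0 T) :
      HasDerivWithinAt (fun s => ((g s : Mat3) * (R s)ᵀ) i j) 0 (Set.Icc 0 T) s := by
    have h : HasDerivWithinAt (fun s => ∑ k, (g s : Mat3) i k * R s j k)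
        (∑ k, (((g s : Mat3) * M) i k * R s j k + (g s : Mat3) i k * (R s * M) j k))
        (Set.Icc 0 T) s :=
      HasDerivWithinAt.fun_sum fun k _ => (hd i k s hs).mul (hR s j k).hasDerivWithinAt
    have h0 : ∑ k, (((g s : Mat3) * M) i k * R s j k + (g s : Mat3) i k * (R s * M) j k) = 0 := by
      have : (g s : Mat3) * M * (R s)ᵀ + (g s : Mat3) * (R s * M)ᵀ = 0 := by
        rw [Matrix.transpose_mul, hu]
        noncomm_ring
      rw [Finset.sum_add_distrib]
      exact congrFun (congrFun this i) j
    rw [h0] at h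
    exact h
  have hP : (g t : Mat3) * (R t)ᵀ = g₀ := by
    ext i j
    have hconst := constant_of_derivWithin_zero
      (fun s hs => (hdP i j s hs).differentiableWithinAt)
      (fun s hs => (hdP i j s (Set.Ico_subset_Icc_self hs)).derivWithin
        (uniqueDiffOn_Icc (hs.1.trans_lt hs.2) s (Set.Ico_subset_Icc_self hs))) t ht
    have h0 := hg 0 ⟨le_rfl, ht.1.trans ht.2⟩ i j
    rw [intervalIntegral.integral_same, add_zero] at h0
    simpa [hR₀, h0] using hconst
  rw [← hP, mul_assoc, hRR, mul_one]

/-- A fundamental solution in `SO(3)` provides a solution with constant control. -/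
theorem isSolution_mul {Q : ℝ → SO3}
    (hQ : ∀ t i j, HasDerivAt (fun t => (Q t : Mat3) i j)
      (((Q t : Mat3) * ∑ k, u k • X k) i j) t)
    (hQ₀ : (Q 0 : Mat3) = 1) (T : ℝ) (g₀ : SO3) :
    IsSolution X T (fun _ => u) g₀ (fun t => g₀ * Q t) := by
  set M := ∑ k, u k • X k
  have hQc : Continuous fun t => (Q t : Mat3) :=
    continuous_matrix fun i j => continuous_iff_continuousAt.2 fun t => (hQ t i j).continuousAt
  refine ⟨(Continuous.subtype_mk (continuous_const.mul hQc) _).continuousOn, fun t _ i j => ?_⟩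
  have hd (s) : HasDerivAt (fun s => ((g₀ : Mat3) * (Q s : Mat3)) i j)
      (((g₀ : Mat3) * (Q s : Mat3) * M) i j) s := by
    simp only [mul_assoc, Matrix.mul_apply (M := (g₀ : Mat3))]
    exact HasDerivAt.fun_sum fun k _ => (hQ s k j).const_mul _
  have hc : Continuous fun s => ((g₀ : Mat3) * (Q s : Mat3) * M) i j := by fun_prop
  have h := intervalIntegral.integral_eq_sub_of_hasDerivAt (fun s _ => hd s)
    (hc.intervalIntegrable 0 t)
  rw [hQ₀, mul_one] at h
  change ((g₀ : Mat3) * (Q t : Mat3)) i j =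
    (g₀ : Mat3) i j + ∫ s in (0 : ℝ)..t, ((g₀ : Mat3) * (Q s : Mat3) * M) i j
  rw [h]
  ring

end ConstantControl

/-! ### Global controllability -/

theorem globallyControllable_genSO : GloballyControllable genSO := by
  rintro _ x₂ T hT g₁ rfl
  induction x₂ using QuotientGroup.induction_on with
  | H g₂ =>
    obtain ⟨a, b, θ, hab, h⟩ := exists_rot_eq (orbitMap (g₁⁻¹ * g₂))
    -- At this constant angular speed the angle `θ` is swept in time exactly `T`.
    set c := θ / T
    have hcT : c * T = θ := div_mul_cancel₀ θ hT.ne'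
    let u : EuclideanSpace ℝ (Fin 2) := !₂[c * a, c * b]
    have hu : ∑ k, u k • genSO k = c • (a • X₁ + b • X₂) := by
      simp [u, genSO, mul_smul]
    let Q (t : ℝ) : SO3 := ⟨rot a b (Real.cos (c * t)) (Real.sin (c * t)),
      rot_mem hab (Real.cos_sq_add_sin_sq _)⟩
    have hQ (t i j) : HasDerivAt (fun t => (Q t : Mat3) i j)
        (((Q t : Mat3) * ∑ k, u k • genSO k) i j) t := by
      rw [hu]
      exact hasDerivAt_rot hab c t i j
    have hQ₀ : (Q 0 : Mat3) = 1 := by simp [Q, rot_one_zero]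
    have hskew : (∑ k, u k • genSO k)ᵀ = -∑ k, u k • genSO k := by
      rw [hu, ← LieAlgebra.Orthogonal.mem_so]
      exact (soThreeModSoTwo.smul_mem c ((mem_soThreeModSoTwo_iff _).2 ⟨a, b, rfl⟩)).1
    refine ⟨fun _ => u, MeasureTheory.memLp_const u, ⟨_, isSolution_mul hQ hQ₀ T g₁⟩, ?_⟩
    intro g hg
    -- Every solution must end at the target, so an arbitrary one is identified with `g₁ Q` at time
    -- `T`.
    have hgT := hg.eq_mul hskew hQ hQ₀ (fun t => (Q t).transpose_mul_self) ⟨hT.le, le_rfl⟩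
    apply injective_toSphere
    apply Subtype.ext
    change act (g T) e₃ = act g₂ e₃
    have hQT : act (Q T) e₃ = act ((g₁ : Mat3)ᵀ * (g₂ : Mat3)) e₃ := by
      simp only [Q, hcT]
      exact h
    rw [hgT, act_mul, hQT, ← act_mul, ← mul_assoc, g₁.mul_transpose_self, one_mul]

theorem mainTheorem2 :
    -- `X₁, X₂` span `so(3)/so(2)`, the complement of `so(2)` in `so(3)`, and are independent
    (LinearIndependent ℝ genSO ∧
      Submodule.span ℝ (Set.range genSO) = soThreeModSoTwo ∧
      soTwo = Submodule.span ℝ {X₃} ∧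
      Disjoint soTwo soThreeModSoTwo ∧
      soTwo ⊔ soThreeModSoTwo = (LieAlgebra.Orthogonal.so (Fin 3) ℝ).toSubmodule) ∧
    -- bracket relations
    (⁅X₁, X₂⁆ = X₃ ∧ ⁅⁅X₁, X₂⁆, X₁⁆ = X₂ ∧ ⁅⁅X₁, X₂⁆, X₂⁆ = -X₁) ∧
    -- the span is a Lie triple system under the double commutator
    (∃ T : soThreeModSoTwo →ₗ[ℝ] soThreeModSoTwo →ₗ[ℝ] soThreeModSoTwo →ₗ[ℝ] soThreeModSoTwo,
      (∀ A B C, (T A B C : Mat3) = ⁅⁅(A : Mat3), (B : Mat3)⁆, (C : Mat3)⁆) ∧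
      IsLieTripleSystem T) ∧
    -- `Θ² = Θ¹` has dimension two
    (Theta genSO 2 = Theta genSO 1 ∧ Module.finrank ℝ (Theta genSO 2) = 2) ∧
    -- `SO(3)/SO(2)` is homeomorphic to the sphere, and its tangent spaces have dimension two
    (IsHomeomorph toSphere ∧ ∀ x : SymSpace, Module.finrank ℝ (tangentAt x) = 2) ∧
    -- Chow's condition and global controllability
    ChowCondition genSO ∧
    GloballyControllable genSO := by
  refine ⟨⟨linearIndependent_genSO, span_genSO, soTwo_eq_span, disjoint_soTwo_soThreeModSoTwo,
    soTwo_sup_soThreeModSoTwo⟩, ⟨lie_X₁_X₂, ?_, ?_⟩,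
    ⟨tripleBracket, coe_tripleBracket, isLieTripleSystem_tripleBracket⟩, ⟨?_, ?_⟩,
    ⟨isHomeomorph_toSphere, finrank_tangentAt⟩, chowCondition_genSO, globallyControllable_genSO⟩
  · rw [lie_X₁_X₂, lie_X₃_X₁]
  · rw [lie_X₁_X₂, lie_X₃_X₂]
  · rw [Theta_genSO_two, Theta_genSO_one]
  · rw [Theta_genSO_two, finrank_soThreeModSoTwo]
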